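/- Let $d\ge 0$. For complex Hilbert spaces $\mathcal U,\mathcal V$, the Schur--Agler class $\mathcal{SA}_d(\mathcal U,\mathcal V)$ consists of the analytic functions $f(z)=\sum_{r\in\mathbb N_0^d} f_r z^r$ on the unit polydisk $\mathbb D^d$, with values in the bounded operators $\mathcal L(\mathcal U,\mathcal V)$, such that for every Hilbert space $\mathcal H$ and every $d$-tuple $T=(T_1,\dots,T_d)$ of commuting operators on $\mathcal H$ with $\|T_i\|<1$ the operator $f(T)=\sum_r f_r\otimes T^r$ from $\mathcal U\otimes\mathcal H$ to $\mathcal V\otimes\mathcal H$ (Hilbert-space tensor products, convergence in operator norm) is well defined and satisfies $\|f(T)\|\le 1$. A matrix-valued function is called Schur--Agler if it is so as a function with values in the operators on $\mathbb C^n$ with its Euclidean norm, and a scalar function if it is so as a function with values in $\mathcal L(\mathbb C,\mathbb C)$. Let $\mathcal V^{\vee k}\subseteq\mathcal V^{\otimes k}$ be the closed subspace of the Hilbert-space tensor power generated by the tensors $v_1\vee\cdots\vee v_k=\sum_{\sigma}v_{\sigma(1)}\otimes\cdots\otimes v_{\sigma(k)}$, where $\sigma$ runs over the permutations of $1,\dots,k$,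 and let $\pi_{\mathcal V^{\vee k}}$ be the orthogonal projection of $\mathcal V^{\otimes k}$ onto it. **Theorem.** Let $\mathcal U$ and $\mathcal V$ be Hilbert spaces and let $S_1,\dots,S_k\in\mathcal{SA}_d(\mathcal U,\mathcal V)$. Then the function $$(S_1\vee\cdots\vee S_k)(z)=\pi_{\mathcal V^{\vee k}}\,\bigl(S_1(z)\otimes\cdots\otimes S_k(z)\bigr)\big|_{\mathcal U^{\vee k}}$$ belongs to $\mathcal{SA}_d(\mathcal U^{\vee k},\mathcal V^{\vee k})$. **Corollary.** Let $S$ be an $n\times n$ matrix-valued Schur--Agler function on $\mathbb D^d$. Then for every $k$ the $k$-th permanental compound of $S$ is Schur--Agler, in both customary senses: the $\binom nk\times\binom nk$ matrix function with entries $\operatorname{per}S(z)[\alpha|\beta]$, where $\alpha,\beta$ run over the strictly increasing sequences of length $k$ in $\{1,\dots,n\}$; and the matrix of $S(z)^{\vee k}$ in the orthonormal basis of normalized symmetric tensors of standard basis vectors, with entries $\operatorname{per}S(z)[\alpha|\beta]/\sqrt{\mu(\alpha)\mu(\beta)}$, where $\alpha,\beta$ run over the nondecreasing sequences of length $k$ and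 $\mu(\alpha)$ is the product of the factorials of the multiplicities in $\alpha$. Here $S(z)[\alpha|\beta]$ is the $k\times k$ matrix with entries $S(z)_{\alpha_i\beta_j}$. In particular, the permanent $\operatorname{per}S(z)$ is a Schur--Agler function. -/

import Mathlib

open scoped TensorProduct

universe w u v

noncomputable section

/-! ### Hilbert-space tensor products -/

/-- The Hilbert-space tensor product: the completion of the algebraic tensor product for the
inner product determined by `⟪a ⊗ b, c ⊗ d⟫ = ⟪a, c⟫ * ⟪b, d⟫`. -/
abbrev HTensor (E : Type u) [NormedAddCommGroup E] [InnerProductSpace ℂ E]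
    (F : Type v) [NormedAddCommGroup F] [InnerProductSpace ℂ F] : Type (max u v) :=
  UniformSpace.Completion (E ⊗[ℂ] F)

/-- The bounded operator `A ⊗ B` between Hilbert-space tensor products. -/
def hmap {E E' F F' : Type*}
    [NormedAddCommGroup E] [InnerProductSpace ℂ E] [NormedAddCommGroup E'] [InnerProductSpace ℂ E']
    [NormedAddCommGroup F] [InnerProductSpace ℂ F] [NormedAddCommGroup F'] [InnerProductSpace ℂ F']
    (A : E →L[ℂ] E') (B : F →L[ℂ] F') : HTensor E F →L[ℂ] HTensor E' F' :=
  (TensorProduct.mapL A B).completion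

/-- A bundled complex Hilbert space, used only to define tensor powers by recursion. -/
structure HilbertBundle : Type (u + 1) where
  carrier : Type u
  [normed : NormedAddCommGroup carrier]
  [inner : InnerProductSpace ℂ carrier]
  [complete : CompleteSpace carrier]

attribute [instance] HilbertBundle.normed HilbertBundle.inner HilbertBundle.complete

/-- The tensor powers as bundled spaces: the zeroth one is the one-dimensional Hilbert space (a
copy of `ℂ` in the universe of `U`), the next one is the Hilbert-space tensor product of `U` with
the preceding one. -/
def tensorPowBundle (U : Type u) [NormedAddCommGroup U] [InnerProductSpace ℂ U] :
    ℕ → HilbertBundle.{u}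
  | 0 => ⟨EuclideanSpace ℂ PUnit.{u + 1}⟩
  | k + 1 => ⟨HTensor U (tensorPowBundle U k).carrier⟩

/-- The `k`-fold Hilbert-space tensor power of `U`. -/
abbrev HTensorPow (U : Type u) [NormedAddCommGroup U] [InnerProductSpace ℂ U] (k : ℕ) : Type u :=
  (tensorPowBundle U k).carrier

/-- The elementary tensor `v₁ ⊗ ⋯ ⊗ v_k`. -/
def elemTensor {U : Type u} [NormedAddCommGroup U] [InnerProductSpace ℂ U] :
    (k : ℕ) → (Fin k → U) → HTensorPow U k
  | 0, _ => (EuclideanSpace.single PUnit.unit 1 : EuclideanSpace ℂ PUnit.{u + 1})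
  | k + 1, x => ((x 0 ⊗ₜ[ℂ] elemTensor k (Fin.tail x) : U ⊗[ℂ] HTensorPow U k) :
      HTensor U (HTensorPow U k))

/-- The bounded operator `A₁ ⊗ ⋯ ⊗ A_k` between tensor powers. -/
def tensorPowMap {U : Type u} {V : Type v} [NormedAddCommGroup U] [InnerProductSpace ℂ U]
    [NormedAddCommGroup V] [InnerProductSpace ℂ V] :
    (k : ℕ) → (Fin k → (U →L[ℂ] V)) → (HTensorPow U k →L[ℂ] HTensorPow V k)
  | 0, _ => (LinearIsometryEquiv.piLpCongrLeft 2 ℂ ℂ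
      Equiv.punitEquivPUnit.{u + 1, v + 1} : EuclideanSpace ℂ PUnit.{u + 1} →L[ℂ]
        EuclideanSpace ℂ PUnit.{v + 1})
  | k + 1, A => hmap (A 0) (tensorPowMap k (Fin.tail A))

/-! ### Symmetric tensor powers -/

/-- The elementary symmetric tensor `v₁ ∨ ⋯ ∨ v_k = ∑_σ v_{σ(1)} ⊗ ⋯ ⊗ v_{σ(k)}`. -/
def symTensor {U : Type u} [NormedAddCommGroup U] [InnerProductSpace ℂ U] {k : ℕ}
    (x : Fin k → U) : HTensorPow U k :=
  ∑ σ : Equiv.Perm (Fin k), elemTensor k (x ∘ σ)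

/-- The `k`-th symmetric tensor power `U^{∨k}`: the closed subspace of the `k`-fold tensor power
generated by the elementary symmetric tensors. -/
abbrev SymPow (U : Type u) [NormedAddCommGroup U] [InnerProductSpace ℂ U] (k : ℕ) :
    Submodule ℂ (HTensorPow U k) :=
  (Submodule.span ℂ (Set.range (symTensor (U := U) (k := k)))).topologicalClosure

/-- `A₁ ∨ ⋯ ∨ A_k`: the compression of `A₁ ⊗ ⋯ ⊗ A_k` to an operator from `U^{∨k}` to
`V^{∨k}`. -/
def symProd {U : Type u} {V : Type v} [NormedAddCommGroup U] [InnerProductSpace ℂ U]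
    [NormedAddCommGroup V] [InnerProductSpace ℂ V] {k : ℕ} (A : Fin k → (U →L[ℂ] V)) :
    SymPow U k →L[ℂ] SymPow V k :=
  (SymPow V k).orthogonalProjectionOnto ∘L tensorPowMap k A ∘L (SymPow U k).subtypeL

/-! ### The Schur–Agler class -/

/-- The open unit polydisk in `ℂ^d`. -/
def polydisk (d : ℕ) : Set (Fin d → ℂ) := {z | ∀ i, ‖z i‖ < 1}

/-- A `d`-tuple of commuting strict contractions. -/
structure IsCommutingStrictContraction {d : ℕ} {H : Type w} [NormedAddCommGroup H]
    [InnerProductSpace ℂ H] (T : Fin d → (H →L[ℂ] H)) : Prop where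
  commute : ∀ i j, Commute (T i) (T j)
  norm_lt_one : ∀ i, ‖T i‖ < 1

/-- The monomial `T^r = T₁^{r₁} ⋯ T_d^{r_d}`. -/
def opMonomial {d : ℕ} {H : Type w} [NormedAddCommGroup H] [InnerProductSpace ℂ H]
    (T : Fin d → (H →L[ℂ] H)) (r : Fin d → ℕ) : H →L[ℂ] H :=
  (List.ofFn fun i => T i ^ r i).prod

/-- The term `c_r ⊗ T^r` of the series `f(T) = ∑_r c_r ⊗ T^r`, for `f(z) = ∑_r c_r z^r`. -/
def seriesTerm {d : ℕ} {U : Type u} {V : Type v} {H : Type w}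
    [NormedAddCommGroup U] [InnerProductSpace ℂ U] [NormedAddCommGroup V] [InnerProductSpace ℂ V]
    [NormedAddCommGroup H] [InnerProductSpace ℂ H]
    (c : (Fin d → ℕ) → (U →L[ℂ] V)) (T : Fin d → (H →L[ℂ] H)) (r : Fin d → ℕ) :
    HTensor U H →L[ℂ] HTensor V H :=
  hmap (c r) (opMonomial T r)

/-- The Schur–Agler class `SA_d(U, V)`: `f` is analytic on the polydisk, and, with
`f(z) = ∑_r c_r z^r` its power series there, the operator `f(T) = ∑_r c_r ⊗ T^r` is well defined
and of norm at most one for every `d`-tuple `T` of commuting strict contractions on a Hilbert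
space. The values of `f` off the polydisk play no role. -/
def IsSchurAgler {d : ℕ} {U : Type u} {V : Type v}
    [NormedAddCommGroup U] [InnerProductSpace ℂ U] [NormedAddCommGroup V] [InnerProductSpace ℂ V]
    (f : (Fin d → ℂ) → (U →L[ℂ] V)) : Prop :=
  AnalyticOnNhd ℂ f (polydisk d) ∧
  ∃ c : (Fin d → ℕ) → (U →L[ℂ] V),
    (∀ z ∈ polydisk d, HasSum (fun r => (∏ i, z i ^ r i) • c r) (f z)) ∧
    ∀ (H : Type w) [NormedAddCommGroup H] [InnerProductSpace ℂ H] [CompleteSpace H]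
      (T : Fin d → (H →L[ℂ] H)), IsCommutingStrictContraction T →
        Summable (seriesTerm c T) ∧ ‖∑' r, seriesTerm c T r‖ ≤ 1

/-- A matrix-valued function is Schur–Agler when it is so as a function with values in the
operators between the Euclidean spaces. -/
def IsMatrixSchurAgler {d : ℕ} {ι : Type u} [Fintype ι] [DecidableEq ι]
    (S : (Fin d → ℂ) → Matrix ι ι ℂ) : Prop :=
  IsSchurAgler.{w} fun z => Matrix.toEuclideanCLM (n := ι) (𝕜 := ℂ) (S z)

/-- A scalar function is Schur–Agler when it is so as a function with values in the operators
on `ℂ`. -/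
def IsScalarSchurAgler {d : ℕ} (f : (Fin d → ℂ) → ℂ) : Prop :=
  IsSchurAgler.{w} fun z => f z • ContinuousLinearMap.id ℂ ℂ

/-! ### Permanental compounds -/

/-- The `k`-th permanental compound of an `n × n` matrix: its entry at a pair of strictly
increasing index sequences of length `k` is the permanent of the corresponding submatrix. -/
def permCompound {n : ℕ} (k : ℕ) (A : Matrix (Fin n) (Fin n) ℂ) :
    Matrix (Fin k ↪o Fin n) (Fin k ↪o Fin n) ℂ :=
  Matrix.of fun α β => (A.submatrix α β).permanent

/-- The product of the factorials of the multiplicities of the values of `α`. -/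
def multFactorial {n k : ℕ} (α : Fin k → Fin n) : ℕ :=
  ∏ i : Fin n, (Finset.univ.filter fun j => α j = i).card.factorial

/-- The full `k`-th permanental compound (the `k`-th induced matrix) of an `n × n` matrix, which
is the matrix of `A^{∨k}` in the orthonormal basis of normalized tensors `e_{α₁} ∨ ⋯ ∨ e_{α_k}`:
it is indexed by nondecreasing sequences of length `k`, with the permanent of the corresponding
submatrix (with repetitions) divided by `√(μ(α) μ(β))` as its entry. -/
def permInduced {n : ℕ} (k : ℕ) (A : Matrix (Fin n) (Fin n) ℂ) :
    Matrix {α : Fin k → Fin n // Monotone α} {α : Fin k → Fin n // Monotone α} ℂ :=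
  Matrix.of fun α β => (A.submatrix α.1 β.1).permanent /
    (Real.sqrt (multFactorial α.1 * multFactorial β.1) : ℂ)

end

/-! The point is that `S₁ ⊗ S₂ = (S₁ ⊗ I)(I ⊗ S₂)` and that evaluation at a commuting tuple respects
this factorization. Since `T^(p+q) = T^p T^q`, multiplying the two absolutely convergent series and
collecting terms with equal `p + q` gives `(S₁ ⊗ S₂)(T) = (S₁ ⊗ I)(T) (I ⊗ S₂)(T)`
(`hasSum_mapH_tensorCoeff`). Each factor is a contraction: reordering the tensor legs is isometric
and intertwines `(I ⊗ S₂)(T)` with `I ⊗ S₂(T)`, and `(S₁ ⊗ I)(T)` with `S₁(T) ⊗ I`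
(`norm_tsum_mapH_id_left_le`, `norm_tsum_mapH_id_right_le`). The intertwiners need not be
surjective. Hence tensor products stay in the class (`IsSchurAgler.tensor`), and by induction so do
tensor products of `k` functions.

The class is also stable under multiplication by constant contractions on both sides
(`IsSchurAgler.comp_comp`). Projection and inclusion of the symmetric powers give the theorem. For
the corollary, the normalized symmetric tensors of basis vectors are orthonormal and the matrix
entries of `S^{⊗k}` between them are normalized permanents, so each compound is a compression of
`S^{⊗k}`, and `per S` is a single diagonal entry. -/

noncomputable section

/-! ### Norm bounds through isometric intertwiners; bounded bilinear maps. -/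

section Intertwining

variable {ι X X' Y Y' : Type*} [NormedAddCommGroup X] [NormedSpace ℂ X]
  [NormedAddCommGroup X'] [NormedSpace ℂ X'] [NormedAddCommGroup Y] [NormedSpace ℂ Y]
  [NormedAddCommGroup Y'] [NormedSpace ℂ Y']

/-- Isometric intertwiners transfer norm bounds from the sum of one series of operators to the sum
of another. -/
theorem norm_tsum_le_of_intertwining {f : ι → (X →L[ℂ] X')} {g : ι → (Y →L[ℂ] Y')}
    {b : Y →L[ℂ] Y'} {W : X →L[ℂ] Y} {W' : X' →L[ℂ] Y'} (hW : ∀ x, ‖W x‖ = ‖x‖)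
    (hW' : ∀ x, ‖W' x‖ = ‖x‖) (hf : Summable f) (hg : HasSum g b)
    (h : ∀ i, W' ∘L f i = g i ∘L W) : ‖∑' i, f i‖ ≤ ‖b‖ := by
  have hint : W' ∘L (∑' i, f i) = b ∘L W := by
    have h1 := (ContinuousLinearMap.compL ℂ X X' Y' W').hasSum hf.hasSum
    have h2 := ((ContinuousLinearMap.compL ℂ X Y Y').flip W).hasSum hg
    refine h1.unique ?_
    have hfun : (fun i => ContinuousLinearMap.compL ℂ X X' Y' W' (f i)) =
        fun i => (ContinuousLinearMap.compL ℂ X Y Y').flip W (g i) := funext h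
    rw [hfun]
    exact h2
  refine ContinuousLinearMap.opNorm_le_bound _ (norm_nonneg b) fun x => ?_
  rw [← hW', ← hW x, ← ContinuousLinearMap.comp_apply, hint]
  exact b.le_opNorm _

variable {Z : Type*} [NormedAddCommGroup Z] [NormedSpace ℂ Z]

/-- A function of two variables that is linear in both and submultiplicative for the norms, as a
bounded bilinear map. -/
def boundedBilinear (f : X → Y → Z) (h1 : ∀ x x' y, f (x + x') y = f x y + f x' y)
    (h2 : ∀ (t : ℂ) x y, f (t • x) y = t • f x y) (h3 : ∀ x y y', f x (y + y') = f x y + f x y')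
    (h4 : ∀ (t : ℂ) x y, f x (t • y) = t • f x y) (h5 : ∀ x y, ‖f x y‖ ≤ ‖x‖ * ‖y‖) :
    X →L[ℂ] Y →L[ℂ] Z :=
  LinearMap.mkContinuous₂ (LinearMap.mk₂ ℂ f h1 h2 h3 h4) 1
    fun x y => by simpa using h5 x y

theorem HasSum.bilinear_left {f : ι → X} {a : X} (hf : HasSum f a) (B : X →L[ℂ] Y →L[ℂ] Z)
    (y : Y) : HasSum (fun i => B (f i) y) (B a y) :=
  (B.flip y).hasSum hf

theorem HasSum.bilinear_right {f : ι → Y} {b : Y} (hf : HasSum f b) (B : X →L[ℂ] Y →L[ℂ] Z)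
    (x : X) : HasSum (fun i => B x (f i)) (B x b) :=
  (B x).hasSum hf

end Intertwining

/-! ### Elementary tensors, operators and isometries on the completed tensor product. -/

section HTensor

variable {E E' F F' G : Type*}
  [NormedAddCommGroup E] [InnerProductSpace ℂ E] [NormedAddCommGroup E'] [InnerProductSpace ℂ E']
  [NormedAddCommGroup F] [InnerProductSpace ℂ F] [NormedAddCommGroup F'] [InnerProductSpace ℂ F']
  [NormedAddCommGroup G] [InnerProductSpace ℂ G]

/-- The elementary tensor `a ⊗ b` in the Hilbert-space tensor product. -/
def htmul (a : E) (b : F) : HTensor E F := ((a ⊗ₜ[ℂ] b : E ⊗[ℂ] F) : HTensor E F)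

theorem htmul_add_left (a a' : E) (b : F) : htmul (a + a') b = htmul a b + htmul a' b := by
  simp [htmul, TensorProduct.add_tmul, UniformSpace.Completion.coe_add]

theorem htmul_add_right (a : E) (b b' : F) : htmul a (b + b') = htmul a b + htmul a b' := by
  simp [htmul, TensorProduct.tmul_add, UniformSpace.Completion.coe_add]

theorem htmul_smul_left (t : ℂ) (a : E) (b : F) : htmul (t • a) b = t • htmul a b := by
  simp [htmul, ← TensorProduct.smul_tmul', UniformSpace.Completion.coe_smul]

theorem htmul_smul_right (t : ℂ) (a : E) (b : F) : htmul a (t • b) = t • htmul a b := by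
  simp [htmul, TensorProduct.tmul_smul, UniformSpace.Completion.coe_smul]

theorem inner_htmul (a a' : E) (b b' : F) :
    inner ℂ (htmul a b) (htmul a' b') = inner ℂ a a' * inner ℂ b b' := by
  simp [htmul, UniformSpace.Completion.inner_coe]

theorem norm_htmul (a : E) (b : F) : ‖htmul a b‖ = ‖a‖ * ‖b‖ := by
  simp [htmul, UniformSpace.Completion.norm_coe]

theorem hmap_htmul (A : E →L[ℂ] E') (B : F →L[ℂ] F') (a : E) (b : F) :
    hmap A B (htmul a b) = htmul (A a) (B b) := by
  simp [hmap, htmul, ContinuousLinearMap.completion_apply_coe]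

/-- Induction principle for closed predicates that are stable under addition. -/
theorem HTensor.induction {p : HTensor E F → Prop} (hc : IsClosed {x | p x})
    (h0 : p 0) (ht : ∀ a b, p (htmul a b)) (ha : ∀ x y, p x → p y → p (x + y)) (x) : p x := by
  induction x using UniformSpace.Completion.induction_on with
  | hp => exact hc
  | ih x =>
    induction x with
    | zero => rw [UniformSpace.Completion.coe_zero]; exact h0
    | tmul a b => exact ht a b
    | add x y hx hy => rw [UniformSpace.Completion.coe_add]; exact ha _ _ hx hy

theorem norm_hmap_le (A : E →L[ℂ] E') (B : F →L[ℂ] F') : ‖hmap A B‖ ≤ ‖A‖ * ‖B‖ := by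
  refine ContinuousLinearMap.opNorm_le_bound _ (by positivity) fun x => ?_
  induction x using UniformSpace.Completion.induction_on with
  | hp => exact isClosed_le (by fun_prop) (by fun_prop)
  | ih x =>
    rw [hmap, ContinuousLinearMap.completion_apply_coe, UniformSpace.Completion.norm_coe,
      UniformSpace.Completion.norm_coe]
    exact (ContinuousLinearMap.le_opNorm _ _).trans
      (mul_le_mul_of_nonneg_right (TensorProduct.norm_mapL_le A B) (norm_nonneg _))

/-- A bilinear map that multiplies inner products extends to an isometry of the Hilbert-space
tensor product. -/
theorem exists_isometry_htensor [CompleteSpace G] (B : E →ₗ[ℂ] F →ₗ[ℂ] G)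
    (hB : ∀ a b a' b', inner ℂ (B a b) (B a' b') = inner ℂ a a' * inner ℂ b b') :
    ∃ W : HTensor E F →L[ℂ] G, (∀ a b, W (htmul a b) = B a b) ∧ ∀ x, ‖W x‖ = ‖x‖ := by
  have hin : ∀ x y : E ⊗[ℂ] F,
      inner ℂ (TensorProduct.lift B x) (TensorProduct.lift B y) = inner ℂ x y := fun x y => by
    induction x with
    | zero => simp
    | add x x' hx hx' => simp only [map_add, inner_add_left, hx, hx']
    | tmul a b =>
      induction y with
      | zero => simp
      | add y y' hy hy' => simp only [map_add, inner_add_right, hy, hy']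
      | tmul a' b' => simp [hB]
  let L : E ⊗[ℂ] F →ₗᵢ[ℂ] G := (TensorProduct.lift B).isometryOfInner hin
  have hW : ∀ x : E ⊗[ℂ] F, L.toContinuousLinearMap.extend
      (UniformSpace.Completion.toComplL (𝕜 := ℂ) (E := E ⊗[ℂ] F)) (x : HTensor E F) = L x :=
    fun x => ContinuousLinearMap.extend_eq _ UniformSpace.Completion.denseRange_coe
      (UniformSpace.Completion.isUniformInducing_coe _) x
  refine ⟨L.toContinuousLinearMap.extend UniformSpace.Completion.toComplL, fun a b => ?_,
    fun x => ?_⟩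
  · rw [htmul, hW]
    simp [L]
  · induction x using UniformSpace.Completion.induction_on with
    | hp => exact isClosed_eq (by fun_prop) (by fun_prop)
    | ih x => rw [hW, L.norm_map, UniformSpace.Completion.norm_coe]

end HTensor

/-- The Hilbert-space tensor product as an opaque type, which carries its Hilbert space structure
but not the many instances of `UniformSpace.Completion`. -/
def HilbTensor (E : Type u) [NormedAddCommGroup E] [InnerProductSpace ℂ E]
    (F : Type v) [NormedAddCommGroup F] [InnerProductSpace ℂ F] : Type (max u v) :=
  HTensor E F

/-! ### Bilinearity of `A ⊗ B`, reordering of tensor legs, amplification by the identity. -/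

section HilbTensor

variable {E E' E'' F F' F'' G : Type*}
  [NormedAddCommGroup E] [InnerProductSpace ℂ E] [NormedAddCommGroup E'] [InnerProductSpace ℂ E']
  [NormedAddCommGroup E''] [InnerProductSpace ℂ E'']
  [NormedAddCommGroup F] [InnerProductSpace ℂ F] [NormedAddCommGroup F'] [InnerProductSpace ℂ F']
  [NormedAddCommGroup F''] [InnerProductSpace ℂ F'']
  [NormedAddCommGroup G] [InnerProductSpace ℂ G]

instance : NormedAddCommGroup (HilbTensor E F) := inferInstanceAs (NormedAddCommGroup (HTensor E F))

instance : InnerProductSpace ℂ (HilbTensor E F) :=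
  inferInstanceAs (InnerProductSpace ℂ (HTensor E F))

instance : CompleteSpace (HilbTensor E F) := inferInstanceAs (CompleteSpace (HTensor E F))

/-- The elementary tensor `a ⊗ b`. -/
def tmulH (a : E) (b : F) : HilbTensor E F := htmul a b

theorem tmulH_add_left (a a' : E) (b : F) : tmulH (a + a') b = tmulH a b + tmulH a' b :=
  htmul_add_left a a' b

theorem tmulH_add_right (a : E) (b b' : F) : tmulH a (b + b') = tmulH a b + tmulH a b' :=
  htmul_add_right a b b'

theorem tmulH_smul_left (t : ℂ) (a : E) (b : F) : tmulH (t • a) b = t • tmulH a b :=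
  htmul_smul_left t a b

theorem tmulH_smul_right (t : ℂ) (a : E) (b : F) : tmulH a (t • b) = t • tmulH a b :=
  htmul_smul_right t a b

theorem inner_tmulH (a a' : E) (b b' : F) :
    inner ℂ (tmulH a b) (tmulH a' b') = inner ℂ a a' * inner ℂ b b' :=
  inner_htmul a a' b b'

theorem norm_tmulH (a : E) (b : F) : ‖tmulH a b‖ = ‖a‖ * ‖b‖ :=
  norm_htmul a b

/-- The bounded operator `A ⊗ B`. -/
def mapH (A : E →L[ℂ] E') (B : F →L[ℂ] F') : HilbTensor E F →L[ℂ] HilbTensor E' F' :=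
  hmap A B

theorem mapH_tmulH (A : E →L[ℂ] E') (B : F →L[ℂ] F') (a : E) (b : F) :
    mapH A B (tmulH a b) = tmulH (A a) (B b) :=
  hmap_htmul A B a b

theorem norm_mapH_le (A : E →L[ℂ] E') (B : F →L[ℂ] F') : ‖mapH A B‖ ≤ ‖A‖ * ‖B‖ :=
  norm_hmap_le A B

/-- Induction principle for closed predicates that are stable under addition. -/
theorem HilbTensor.induction {p : HilbTensor E F → Prop} (hc : IsClosed {x | p x})
    (h0 : p 0) (ht : ∀ a b, p (tmulH a b)) (ha : ∀ x y, p x → p y → p (x + y)) (x) : p x :=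
  HTensor.induction hc h0 ht ha x

/-- A bilinear map that multiplies inner products extends to an isometry of the Hilbert-space
tensor product. -/
theorem exists_isometry_hilbTensor [CompleteSpace G] (B : E →ₗ[ℂ] F →ₗ[ℂ] G)
    (hB : ∀ a b a' b', inner ℂ (B a b) (B a' b') = inner ℂ a a' * inner ℂ b b') :
    ∃ W : HilbTensor E F →L[ℂ] G, (∀ a b, W (tmulH a b) = B a b) ∧ ∀ x, ‖W x‖ = ‖x‖ :=
  exists_isometry_htensor B hB

theorem HilbTensor.ext_tmulH {K : Type*} [NormedAddCommGroup K] [NormedSpace ℂ K]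
    {A B : HilbTensor E F →L[ℂ] K} (h : ∀ a b, A (tmulH a b) = B (tmulH a b)) : A = B := by
  ext x
  induction x using HilbTensor.induction with
  | hc => exact isClosed_eq A.continuous B.continuous
  | h0 => simp
  | ht a b => exact h a b
  | ha x y hx hy => simp [hx, hy]

theorem mapH_comp (A : E' →L[ℂ] E'') (A' : E →L[ℂ] E') (B : F' →L[ℂ] F'') (B' : F →L[ℂ] F') :
    mapH (A ∘L A') (B ∘L B') = mapH A B ∘L mapH A' B' :=
  HilbTensor.ext_tmulH fun a b => by simp [mapH_tmulH]

theorem mapH_add_left (A A' : E →L[ℂ] E') (B : F →L[ℂ] F') :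
    mapH (A + A') B = mapH A B + mapH A' B :=
  HilbTensor.ext_tmulH fun a b => by
    rw [_root_.add_apply, mapH_tmulH, mapH_tmulH, mapH_tmulH, _root_.add_apply, tmulH_add_left]

theorem mapH_add_right (A : E →L[ℂ] E') (B B' : F →L[ℂ] F') :
    mapH A (B + B') = mapH A B + mapH A B' :=
  HilbTensor.ext_tmulH fun a b => by
    rw [_root_.add_apply, mapH_tmulH, mapH_tmulH, mapH_tmulH, _root_.add_apply, tmulH_add_right]

theorem mapH_smul_left (t : ℂ) (A : E →L[ℂ] E') (B : F →L[ℂ] F') :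
    mapH (t • A) B = t • mapH A B :=
  HilbTensor.ext_tmulH fun a b => by
    rw [_root_.smul_apply, mapH_tmulH, mapH_tmulH, _root_.smul_apply, tmulH_smul_left]

theorem mapH_smul_right (t : ℂ) (A : E →L[ℂ] E') (B : F →L[ℂ] F') :
    mapH A (t • B) = t • mapH A B :=
  HilbTensor.ext_tmulH fun a b => by
    rw [_root_.smul_apply, mapH_tmulH, mapH_tmulH, _root_.smul_apply, tmulH_smul_right]

variable (E E' F F') in
/-- `mapH` as a bounded bilinear map. -/
def mapHL : (E →L[ℂ] E') →L[ℂ] (F →L[ℂ] F') →L[ℂ] (HilbTensor E F →L[ℂ] HilbTensor E' F') :=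
  boundedBilinear (X := E →L[ℂ] E') (Y := F →L[ℂ] F')
    (Z := HilbTensor E F →L[ℂ] HilbTensor E' F')
    mapH mapH_add_left mapH_smul_left mapH_add_right mapH_smul_right norm_mapH_le

theorem mapHL_apply (A : E →L[ℂ] E') (B : F →L[ℂ] F') : mapHL E E' F F' A B = mapH A B :=
  rfl

theorem HasSum.mapH_right {ι : Type*} {f : ι → (F →L[ℂ] F')} {b : F →L[ℂ] F'} (hf : HasSum f b)
    (A : E →L[ℂ] E') : HasSum (fun i => mapH A (f i)) (mapH A b) :=
  HasSum.bilinear_right (X := E →L[ℂ] E') (Y := F →L[ℂ] F')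
    (Z := HilbTensor E F →L[ℂ] HilbTensor E' F')
    hf (mapHL E E' F F') A

theorem HasSum.mapH_left {ι : Type*} {f : ι → (E →L[ℂ] E')} {b : E →L[ℂ] E'} (hf : HasSum f b)
    (B : F →L[ℂ] F') : HasSum (fun i => mapH (f i) B) (mapH b B) :=
  HasSum.bilinear_left (X := E →L[ℂ] E') (Y := F →L[ℂ] F')
    (Z := HilbTensor E F →L[ℂ] HilbTensor E' F')
    hf (mapHL E E' F F') B

variable (F) in
/-- The operator `a ↦ a ⊗ h`. -/
def tmulRight (h : G) : F →L[ℂ] HilbTensor F G :=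
  LinearMap.mkContinuous
    { toFun := fun b => tmulH b h
      map_add' := fun _ _ => tmulH_add_left _ _ _
      map_smul' := fun _ _ => tmulH_smul_left _ _ _ } ‖h‖
    fun b => (norm_tmulH b h).trans_le (mul_comm _ _).le

@[simp] theorem tmulRight_apply (h : G) (b : F) : tmulRight F h b = tmulH b h := rfl

/-- The input that makes reassociation isometric. The first leg `x` is an arbitrary element of a
completed tensor product, so reassociation is written as `x ↦ (I ⊗ (· ⊗ h)) x` and the identity is
checked by density in both arguments. -/
theorem inner_mapH_tmulRight_right (h h' : G) (x x' : HilbTensor E F) :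
    inner ℂ (mapH (.id ℂ E) (tmulRight F h) x) (mapH (.id ℂ E) (tmulRight F h') x') =
      inner ℂ x x' * inner ℂ h h' := by
  induction x using HilbTensor.induction with
  | hc => exact isClosed_eq (by fun_prop) (by fun_prop)
  | h0 => simp
  | ha x y hx hy => simp only [map_add, inner_add_left, hx, hy, add_mul]
  | ht a b =>
    induction x' using HilbTensor.induction with
    | hc => exact isClosed_eq (by fun_prop) (by fun_prop)
    | h0 => simp
    | ha x y hx hy => simp only [map_add, inner_add_right, hx, hy, add_mul]
    | ht a' b' => simp [mapH_tmulH, inner_tmulH, mul_assoc]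

theorem inner_mapH_tmulRight_left (h h' : G) (x x' : HilbTensor E F) :
    inner ℂ (mapH (tmulRight E h) (.id ℂ F) x) (mapH (tmulRight E h') (.id ℂ F) x') =
      inner ℂ x x' * inner ℂ h h' := by
  induction x using HilbTensor.induction with
  | hc => exact isClosed_eq (by fun_prop) (by fun_prop)
  | h0 => simp
  | ha x y hx hy => simp only [map_add, inner_add_left, hx, hy, add_mul]
  | ht a b =>
    induction x' using HilbTensor.induction with
    | hc => exact isClosed_eq (by fun_prop) (by fun_prop)
    | h0 => simp
    | ha x y hx hy => simp only [map_add, inner_add_right, hx, hy, add_mul]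
    | ht a' b' => simp [mapH_tmulH, inner_tmulH, mul_right_comm]

variable (E F G) in
/-- The isometry `(E ⊗ F) ⊗ G → E ⊗ (F ⊗ G)`. -/
theorem exists_isometry_assoc :
    ∃ W : HilbTensor (HilbTensor E F) G →L[ℂ] HilbTensor E (HilbTensor F G),
      (∀ x h, W (tmulH x h) = mapH (.id ℂ E) (tmulRight F h) x) ∧ ∀ x, ‖W x‖ = ‖x‖ :=
  exists_isometry_hilbTensor
    (LinearMap.mk₂ ℂ (fun x h => mapH (.id ℂ E) (tmulRight F h) x)
      (fun x x' h => map_add _ _ _) (fun t x h => map_smul _ _ _)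
      (fun x h h' => by
        rw [← _root_.add_apply]
        congr 1
        exact HilbTensor.ext_tmulH fun a b => by simp [mapH_tmulH, tmulH_add_right])
      (fun t x h => by
        rw [← _root_.smul_apply]
        congr 1
        exact HilbTensor.ext_tmulH fun a b => by simp [mapH_tmulH, tmulH_smul_right]))
    fun x h x' h' => inner_mapH_tmulRight_right h h' x x'

variable (E F G) in
/-- The isometry `(E ⊗ F) ⊗ G → (E ⊗ G) ⊗ F`. -/
theorem exists_isometry_rightComm :
    ∃ W : HilbTensor (HilbTensor E F) G →L[ℂ] HilbTensor (HilbTensor E G) F,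
      (∀ x h, W (tmulH x h) = mapH (tmulRight E h) (.id ℂ F) x) ∧ ∀ x, ‖W x‖ = ‖x‖ :=
  exists_isometry_hilbTensor
    (LinearMap.mk₂ ℂ (fun x h => mapH (tmulRight E h) (.id ℂ F) x)
      (fun x x' h => map_add _ _ _) (fun t x h => map_smul _ _ _)
      (fun x h h' => by
        rw [← _root_.add_apply]
        congr 1
        exact HilbTensor.ext_tmulH fun a b => by simp [mapH_tmulH, tmulH_add_right, tmulH_add_left])
      (fun t x h => by
        rw [← _root_.smul_apply]
        congr 1
        exact HilbTensor.ext_tmulH fun a b => by simp [mapH_tmulH, tmulH_smul_right, tmulH_smul_left]))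
    fun x h x' h' => inner_mapH_tmulRight_left h h' x x'

/-- Tensoring a series of operators `c ⊗ T` with an identity on the left of the first leg does not
increase its norm. -/
theorem norm_tsum_mapH_id_left_le {ι : Type*} (c : ι → (F →L[ℂ] F')) (T : ι → (G →L[ℂ] G))
    (hs : Summable fun i => mapH (c i) (T i))
    (hs' : Summable fun i => mapH (mapH (.id ℂ E) (c i)) (T i)) :
    ‖∑' i, mapH (mapH (.id ℂ E) (c i)) (T i)‖ ≤ ‖∑' i, mapH (c i) (T i)‖ := by
  obtain ⟨W, hW, hWn⟩ := exists_isometry_assoc E F G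
  obtain ⟨W', hW', hWn'⟩ := exists_isometry_assoc E F' G
  have key (i) : W' ∘L mapH (mapH (.id ℂ E) (c i)) (T i) =
      mapH (.id ℂ E) (mapH (c i) (T i)) ∘L W := by
    refine HilbTensor.ext_tmulH fun x h => ?_
    simp only [ContinuousLinearMap.comp_apply, mapH_tmulH, hW, hW']
    -- With both sides written as a single operator `I ⊗ _` applied to `x`, it remains to see that
    -- `b ↦ c b ⊗ T h` arises in both orders.
    rw [← ContinuousLinearMap.comp_apply, ← ContinuousLinearMap.comp_apply, ← mapH_comp,
      ← mapH_comp]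
    congr 2
    ext b
    simp [mapH_tmulH]
  have hg := hs.hasSum.mapH_right (.id ℂ E)
  refine (norm_tsum_le_of_intertwining (X := HilbTensor (HilbTensor E F) G)
    (X' := HilbTensor (HilbTensor E F') G)
    (Y := HilbTensor E (HilbTensor F G)) (Y' := HilbTensor E (HilbTensor F' G))
    hWn hWn' hs' hg key).trans ?_
  refine (norm_mapH_le _ _).trans ?_
  exact mul_le_of_le_one_left (norm_nonneg (∑' i, mapH (c i) (T i))) ContinuousLinearMap.norm_id_le

/-- Tensoring a series of operators `c ⊗ T` with an identity on the right of the first leg does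
not increase its norm. -/
theorem norm_tsum_mapH_id_right_le {ι : Type*} (c : ι → (E →L[ℂ] E')) (T : ι → (G →L[ℂ] G))
    (hs : Summable fun i => mapH (c i) (T i))
    (hs' : Summable fun i => mapH (mapH (c i) (.id ℂ F)) (T i)) :
    ‖∑' i, mapH (mapH (c i) (.id ℂ F)) (T i)‖ ≤ ‖∑' i, mapH (c i) (T i)‖ := by
  obtain ⟨W, hW, hWn⟩ := exists_isometry_rightComm E F G
  obtain ⟨W', hW', hWn'⟩ := exists_isometry_rightComm E' F G
  have key (i) : W' ∘L mapH (mapH (c i) (.id ℂ F)) (T i) =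
      mapH (mapH (c i) (T i)) (.id ℂ F) ∘L W := by
    refine HilbTensor.ext_tmulH fun x h => ?_
    simp only [ContinuousLinearMap.comp_apply, mapH_tmulH, hW, hW']
    rw [← ContinuousLinearMap.comp_apply, ← ContinuousLinearMap.comp_apply, ← mapH_comp,
      ← mapH_comp]
    congr 2
    ext b
    simp [mapH_tmulH]
  have hg := hs.hasSum.mapH_left (.id ℂ F)
  refine (norm_tsum_le_of_intertwining (X := HilbTensor (HilbTensor E F) G)
    (X' := HilbTensor (HilbTensor E' F) G)
    (Y := HilbTensor (HilbTensor E G) F) (Y' := HilbTensor (HilbTensor E' G) F)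
    hWn hWn' hs' hg key).trans ?_
  refine (norm_mapH_le _ _).trans ?_
  exact mul_le_of_le_one_right (norm_nonneg (∑' i, mapH (c i) (T i))) ContinuousLinearMap.norm_id_le

end HilbTensor

/-! ### Absolute convergence and Cauchy products of multiple power series. -/

section Series

variable {ι κ X Y Z : Type*} [NormedAddCommGroup X] [NormedSpace ℂ X] [NormedAddCommGroup Y]
  [NormedSpace ℂ Y] [NormedAddCommGroup Z] [NormedSpace ℂ Z]

/-- The product of two absolutely convergent series under a bounded bilinear map. -/
theorem HasSum.bilinear_prod [CompleteSpace Z] (B : X →L[ℂ] Y →L[ℂ] Z) {f : ι → X} {g : κ → Y}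
    {a : X} {b : Y} (hf : HasSum f a) (hg : HasSum g b) (hf' : Summable fun i => ‖f i‖)
    (hg' : Summable fun j => ‖g j‖) :
    HasSum (fun p : ι × κ => B (f p.1) (g p.2)) (B a b) := by
  have hs : Summable fun p : ι × κ => B (f p.1) (g p.2) := by
    refine Summable.of_norm_bounded
      ((hf'.mul_of_nonneg hg' (fun _ => norm_nonneg _) fun _ => norm_nonneg _).mul_left ‖B‖)
      fun p => ?_
    rw [← mul_assoc]
    exact B.le_opNorm₂ _ _
  -- The norm bound yields summability only; the iterated sum identifies the value as `B a b`.
  have h1 := hs.hasSum.prod_fiberwise fun i => hg.bilinear_right B (f i)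
  exact h1.unique (hf.bilinear_left B b) ▸ hs.hasSum

theorem summable_prod_pow {d : ℕ} {t : ℝ} (h0 : 0 ≤ t) (h1 : t < 1) :
    Summable fun r : Fin d → ℕ => ∏ i, t ^ r i := by
  induction d with
  | zero => exact (hasSum_fintype _).summable
  | succ d ih =>
    rw [← (Fin.consEquiv fun _ : Fin (d + 1) => ℕ).summable_iff]
    refine ((summable_geometric_of_lt_one h0 h1).mul_of_nonneg ih (fun n => pow_nonneg h0 n)
      fun r => Finset.prod_nonneg fun i _ => pow_nonneg h0 _).congr fun p => ?_
    simp [Fin.prod_univ_succ, Fin.consEquiv]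

/-- A multiple power series that converges on the polydisk converges absolutely there. -/
theorem summable_norm_coeff_mul {d : ℕ} {c : (Fin d → ℕ) → X}
    (hc : ∀ z ∈ polydisk d, Summable fun r => (∏ i, z i ^ r i) • c r) {t : ℝ}
    (h0 : 0 ≤ t) (h1 : t < 1) : Summable fun r => ‖c r‖ * ∏ i, t ^ r i := by
  -- Abel's lemma: the terms at `(ρ, …, ρ)` tend to zero, hence are bounded, and a geometric series
  -- in `t / ρ` dominates.
  obtain ⟨ρ, htρ, hρ1⟩ := exists_between h1
  have hρ : 0 < ρ := h0.trans_lt htρ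
  have hz : (fun _ => (ρ : ℂ)) ∈ polydisk d := fun i => by
    simpa [abs_of_pos hρ] using hρ1
  obtain ⟨M, hM⟩ := (hc _ hz).tendsto_cofinite_zero.norm.bddAbove_range_of_cofinite
  refine Summable.of_nonneg_of_le (fun r => by positivity) (fun r => ?_)
    ((summable_prod_pow (d := d) (div_nonneg h0 hρ.le) ((div_lt_one hρ).2 htρ)).mul_left M)
  have hr : ‖(∏ i, (ρ : ℂ) ^ r i) • c r‖ ≤ M := hM ⟨r, rfl⟩
  rw [norm_smul, norm_prod] at hr
  simp only [norm_pow, Complex.norm_real, Real.norm_of_nonneg hρ.le] at hr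
  calc ‖c r‖ * ∏ i, t ^ r i = ((∏ i, ρ ^ r i) * ‖c r‖) * ∏ i, (t / ρ) ^ r i := by
        have : ∏ i, t ^ r i = (∏ i, ρ ^ r i) * ∏ i, (t / ρ) ^ r i := by
          rw [← Finset.prod_mul_distrib]
          refine Finset.prod_congr rfl fun i _ => ?_
          rw [← mul_pow, mul_div_cancel₀ _ hρ.ne']
        rw [this]
        ring
    _ ≤ _ := by gcongr

/-- Both summands are at most `r`. Hence each Cauchy coefficient is a finite sum, and linear maps
pass through it without any continuity. -/
theorem finite_fiber_add {d : ℕ} (r : Fin d → ℕ) :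
    Finite ((fun p : (Fin d → ℕ) × (Fin d → ℕ) => p.1 + p.2) ⁻¹' {r}) := by
  refine ((Set.finite_Iic r).prod (Set.finite_Iic r)).subset ?_
  rintro ⟨p, q⟩ rfl
  exact ⟨le_self_add (a := p) (b := q), le_add_self (a := q) (b := p)⟩

/-- Grouping the terms of a double series by the sum of their indices. -/
theorem HasSum.fiberwise_add {d : ℕ} [CompleteSpace Z] {Λ : (Fin d → ℕ) → (X →ₗ[ℂ] Z)}
    {ψ : (Fin d → ℕ) × (Fin d → ℕ) → X} {s : Z}
    (h : HasSum (fun p => Λ (p.1 + p.2) (ψ p)) s) :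
    HasSum (fun r => Λ r (∑' p : (fun p : (Fin d → ℕ) × (Fin d → ℕ) => p.1 + p.2) ⁻¹' {r}, ψ p))
      s := by
  convert h.tsum_fiberwise fun p => p.1 + p.2 using 2 with r
  have := finite_fiber_add r
  have := Fintype.ofFinite ((fun p : (Fin d → ℕ) × (Fin d → ℕ) => p.1 + p.2) ⁻¹' {r})
  rw [tsum_fintype, tsum_fintype, map_sum]
  refine Finset.sum_congr rfl fun p _ => ?_
  rw [show p.1.1 + p.1.2 = r from p.2]

end Series

/-! ### Monomials in commuting operators. -/

section Monomials

theorem List.prod_ofFn_mul_of_commute {M : Type*} [Monoid M] {d : ℕ} (f g : Fin d → M)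
    (h : ∀ i j, Commute (f i) (g j)) :
    (List.ofFn fun i => f i * g i).prod = (List.ofFn f).prod * (List.ofFn g).prod := by
  induction d with
  | zero => simp
  | succ d ih =>
    rw [List.ofFn_succ, List.ofFn_succ, List.ofFn_succ, List.prod_cons, List.prod_cons,
      List.prod_cons, ih _ _ fun i j => h _ _]
    have hc : Commute (g 0) (List.ofFn fun i : Fin d => f i.succ).prod :=
      Commute.list_prod_right _ _ fun x hx => by
        obtain ⟨i, rfl⟩ := (List.mem_ofFn' _ _).1 hx
        exact (h _ _).symm
    rw [mul_assoc, mul_assoc, ← mul_assoc (g 0), hc.eq, mul_assoc]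

variable {d : ℕ} {H : Type*} [NormedAddCommGroup H] [InnerProductSpace ℂ H]
  {T : Fin d → (H →L[ℂ] H)}

theorem opMonomial_zero : opMonomial T 0 = 1 := by
  simp [opMonomial]

/-- The only place where commutativity of the tuple enters: it makes evaluation at `T`
multiplicative. -/
theorem opMonomial_add (hT : ∀ i j, Commute (T i) (T j)) (p q : Fin d → ℕ) :
    opMonomial T (p + q) = opMonomial T p * opMonomial T q := by
  simp only [opMonomial, Pi.add_apply, pow_add]
  exact List.prod_ofFn_mul_of_commute _ _ fun i j => (hT i j).pow_pow _ _

theorem norm_pow_le_pow_of_norm_le {A : H →L[ℂ] H} {t : ℝ} (hA : ‖A‖ ≤ t) (n : ℕ) :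
    ‖A ^ n‖ ≤ t ^ n := by
  -- Exponent zero is separate because the identity of the zero space has norm `0`, not `1`.
  rcases n.eq_zero_or_pos with rfl | hn
  · rw [pow_zero, pow_zero]
    exact ContinuousLinearMap.norm_id_le
  · exact (norm_pow_le' A hn).trans (pow_le_pow_left₀ (norm_nonneg _) hA n)

theorem norm_opMonomial_le {t : ℝ} (h0 : 0 ≤ t) (hT : ∀ i, ‖T i‖ ≤ t) (r : Fin d → ℕ) :
    ‖opMonomial T r‖ ≤ ∏ i, t ^ r i := by
  unfold opMonomial
  induction d with
  | zero =>
    rw [List.ofFn_zero, List.prod_nil, Finset.univ_eq_empty, Finset.prod_empty]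
    exact ContinuousLinearMap.norm_id_le
  | succ d ih =>
    rw [List.ofFn_succ, List.prod_cons, Fin.prod_univ_succ]
    exact (norm_mul_le _ _).trans (mul_le_mul (norm_pow_le_pow_of_norm_le (hT 0) _)
      (ih (T := fun i => T i.succ) (fun i => hT _) _) (norm_nonneg _) (by positivity))

theorem exists_bound_lt_one {X : Type*} [NormedAddCommGroup X] {x : Fin d → X}
    (hx : ∀ i, ‖x i‖ < 1) : ∃ t : ℝ, 0 ≤ t ∧ t < 1 ∧ ∀ i, ‖x i‖ ≤ t := by
  obtain ⟨t, ht1, ht⟩ : ∃ t < (1 : ℝ), ∀ i, ‖x i‖ ≤ t := by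
    rcases isEmpty_or_nonempty (Fin d) with he | hne
    · exact ⟨0, one_pos, fun i => he.elim i⟩
    · obtain ⟨i, hi⟩ := Finite.exists_max fun i => ‖x i‖
      exact ⟨_, hx i, hi⟩
  exact ⟨max t 0, le_max_right _ _, max_lt ht1 one_pos, fun i => (ht i).trans (le_max_left _ _)⟩

end Monomials

/-! ### Stability of the Schur–Agler class under compressions and tensor products. -/

section SchurAgler

variable {d : ℕ} {U : Type*} {V : Type*} {U' : Type*} {V' : Type*}
  [NormedAddCommGroup U] [InnerProductSpace ℂ U] [NormedAddCommGroup V] [InnerProductSpace ℂ V]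
  [NormedAddCommGroup U'] [InnerProductSpace ℂ U']
  [NormedAddCommGroup V'] [InnerProductSpace ℂ V']

/-- Moves the definition to `HilbTensor`, which unfolds to `HTensor`, and replaces the `tsum` by an
explicit sum `b`. -/
theorem isSchurAgler_iff {f : (Fin d → ℂ) → (U →L[ℂ] V)} : IsSchurAgler.{w} f ↔
    AnalyticOnNhd ℂ f (polydisk d) ∧ ∃ c : (Fin d → ℕ) → (U →L[ℂ] V),
      (∀ z ∈ polydisk d, HasSum (fun r => (∏ i, z i ^ r i) • c r) (f z)) ∧
      ∀ (H : Type w) [NormedAddCommGroup H] [InnerProductSpace ℂ H] [CompleteSpace H]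
        (T : Fin d → (H →L[ℂ] H)), IsCommutingStrictContraction T →
          ∃ b : HilbTensor U H →L[ℂ] HilbTensor V H,
            HasSum (fun r => mapH (c r) (opMonomial T r)) b ∧ ‖b‖ ≤ 1 := by
  have key (c : (Fin d → ℕ) → (U →L[ℂ] V)) (H : Type w) [NormedAddCommGroup H]
      [InnerProductSpace ℂ H] (T : Fin d → (H →L[ℂ] H)) :
      (Summable (seriesTerm c T) ∧ ‖∑' r, seriesTerm c T r‖ ≤ 1) ↔
      (Summable (fun r => mapH (c r) (opMonomial T r)) ∧
        ‖∑' r, mapH (c r) (opMonomial T r)‖ ≤ 1) := Iff.rfl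
  have key' (c : (Fin d → ℕ) → (U →L[ℂ] V)) (H : Type w) [NormedAddCommGroup H]
      [InnerProductSpace ℂ H] (T : Fin d → (H →L[ℂ] H)) :
      (Summable (fun r => mapH (c r) (opMonomial T r)) ∧
        ‖∑' r, mapH (c r) (opMonomial T r)‖ ≤ 1) ↔ ∃ b : HilbTensor U H →L[ℂ] HilbTensor V H,
            HasSum (fun r => mapH (c r) (opMonomial T r)) b ∧ ‖b‖ ≤ 1 :=
    ⟨fun h => ⟨_, h.1.hasSum, h.2⟩, fun ⟨b, hb, hb'⟩ => ⟨hb.summable, hb.tsum_eq ▸ hb'⟩⟩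
  simp only [IsSchurAgler, key, key']

/-- Supplies the empty tensor product, the base of the induction on `k`. -/
theorem isSchurAgler_const {A : U →L[ℂ] V} (hA : ‖A‖ ≤ 1) :
    IsSchurAgler.{w} fun _ : Fin d → ℂ => A := by
  refine isSchurAgler_iff.2 ⟨analyticOnNhd_const, Pi.single 0 A, fun z _ => ?_,
    fun H _ _ _ T _ => ⟨mapH A 1, ?_, ?_⟩⟩
  · convert hasSum_single (f := fun r => (∏ i, z i ^ r i) • (Pi.single 0 A : (Fin d → ℕ) → _) r)
      0 fun r hr => by simp [hr]
    simp
  · convert hasSum_single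
      (f := fun r => mapH ((Pi.single 0 A : (Fin d → ℕ) → _) r) (opMonomial T r))
      0 fun r hr => by
        rw [Pi.single_eq_of_ne hr, ← mapHL_apply, map_zero, _root_.zero_apply]
    · rw [Pi.single_eq_same]
    · exact opMonomial_zero.symm
  · exact (norm_mapH_le _ _).trans
      (mul_le_one₀ hA (norm_nonneg _) ContinuousLinearMap.norm_id_le)

/-- Compressions of Schur–Agler functions by contractions are Schur–Agler. -/
theorem IsSchurAgler.comp_comp {f : (Fin d → ℂ) → (U →L[ℂ] V)} (hf : IsSchurAgler.{w} f)
    {A : V →L[ℂ] V'} {B : U' →L[ℂ] U} (hA : ‖A‖ ≤ 1) (hB : ‖B‖ ≤ 1) :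
    IsSchurAgler.{w} fun z => A ∘L f z ∘L B := by
  obtain ⟨han, c, hc, hT⟩ := isSchurAgler_iff.1 hf
  let L : (U →L[ℂ] V) →L[ℂ] (U' →L[ℂ] V') :=
    ContinuousLinearMap.compL ℂ U' V V' A ∘L (ContinuousLinearMap.compL ℂ U' U V).flip B
  refine isSchurAgler_iff.2 ⟨L.comp_analyticOnNhd han, fun r => A ∘L c r ∘L B, fun z hz => ?_,
    fun H _ _ _ T hTc => ?_⟩
  · refine (L.hasSum (hc z hz)).congr_fun fun r => ?_
    simp [L]
  · obtain ⟨b, hb, hb1⟩ := hT H T hTc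
    -- `(A c_r B) ⊗ T^r = (A ⊗ I)(c_r ⊗ T^r)(B ⊗ I)`, so the evaluated series is compressed by
    -- contractions as well.
    let L' : (HilbTensor U H →L[ℂ] HilbTensor V H) →L[ℂ]
        (HilbTensor U' H →L[ℂ] HilbTensor V' H) :=
      ContinuousLinearMap.compL ℂ _ _ _ (mapH A (.id ℂ H)) ∘L
        (ContinuousLinearMap.compL ℂ _ _ _).flip (mapH B (.id ℂ H))
    refine ⟨L' b, ?_, ?_⟩
    · refine (L'.hasSum hb).congr_fun fun r => ?_
      simp [L', ← mapH_comp]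
    · have h1 : ‖mapH A (.id ℂ H)‖ ≤ 1 := (norm_mapH_le _ _).trans
        (mul_le_one₀ hA (norm_nonneg _) ContinuousLinearMap.norm_id_le)
      have h2 : ‖mapH B (.id ℂ H)‖ ≤ 1 := (norm_mapH_le _ _).trans
        (mul_le_one₀ hB (norm_nonneg _) ContinuousLinearMap.norm_id_le)
      refine (ContinuousLinearMap.opNorm_comp_le _ _).trans
        (mul_le_one₀ h1 (norm_nonneg _) ((ContinuousLinearMap.opNorm_comp_le _ _).trans
        (mul_le_one₀ hb1 (norm_nonneg _) h2)))

/-- The coefficients of the tensor product of two power series. -/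
def tensorCoeff (a : (Fin d → ℕ) → (U →L[ℂ] V)) (b : (Fin d → ℕ) → (U' →L[ℂ] V'))
    (r : Fin d → ℕ) : HilbTensor U U' →L[ℂ] HilbTensor V V' :=
  ∑' p : (fun p : (Fin d → ℕ) × (Fin d → ℕ) => p.1 + p.2) ⁻¹' {r}, mapH (a p.1.1) (b p.1.2)

theorem hasSum_tensorCoeff {a : (Fin d → ℕ) → (U →L[ℂ] V)} {b : (Fin d → ℕ) → (U' →L[ℂ] V')}
    {z : Fin d → ℂ} {A : U →L[ℂ] V} {B : U' →L[ℂ] V'}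
    (ha : HasSum (fun r => (∏ i, z i ^ r i) • a r) A)
    (hb : HasSum (fun r => (∏ i, z i ^ r i) • b r) B)
    (ha' : Summable fun r => ‖(∏ i, z i ^ r i) • a r‖)
    (hb' : Summable fun r => ‖(∏ i, z i ^ r i) • b r‖) :
    HasSum (fun r => (∏ i, z i ^ r i) • tensorCoeff a b r) (mapH A B) := by
  have hs := HasSum.bilinear_prod (Z := HilbTensor U U' →L[ℂ] HilbTensor V V')
    (mapHL U V U' V') ha hb ha' hb'
  refine HasSum.fiberwise_add (X := HilbTensor U U' →L[ℂ] HilbTensor V V')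
    (Z := HilbTensor U U' →L[ℂ] HilbTensor V V')
    (Λ := fun r => LinearMap.lsmul ℂ _ (∏ i, z i ^ r i))
    (ψ := fun p => mapH (a p.1) (b p.2)) (hs.congr_fun fun p => ?_)
  rw [mapHL_apply, mapH_smul_left, mapH_smul_right, smul_smul, ← Finset.prod_mul_distrib]
  simp_rw [← pow_add]
  rfl

/-- Termwise, `((a_p ⊗ I) ⊗ T^p)((I ⊗ b_q) ⊗ T^q) = (a_p ⊗ b_q) ⊗ T^(p+q)`, passing through the
intermediate space `U ⊗ V'`. -/
theorem hasSum_mapH_tensorCoeff {H : Type*} [NormedAddCommGroup H] [InnerProductSpace ℂ H]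
    {T : Fin d → (H →L[ℂ] H)} (hT : ∀ i j, Commute (T i) (T j))
    {a : (Fin d → ℕ) → (U →L[ℂ] V)} {b : (Fin d → ℕ) → (U' →L[ℂ] V')}
    (ha : Summable fun r => ‖mapH (mapH (a r) (.id ℂ V')) (opMonomial T r)‖)
    (hb : Summable fun r => ‖mapH (mapH (.id ℂ U) (b r)) (opMonomial T r)‖) :
    HasSum (fun r => mapH (tensorCoeff a b r) (opMonomial T r))
      ((∑' r, mapH (mapH (a r) (.id ℂ V')) (opMonomial T r)) ∘L
        ∑' r, mapH (mapH (.id ℂ U) (b r)) (opMonomial T r)) := by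
  have hs := HasSum.bilinear_prod
    (X := HilbTensor (HilbTensor U V') H →L[ℂ] HilbTensor (HilbTensor V V') H)
    (Y := HilbTensor (HilbTensor U U') H →L[ℂ] HilbTensor (HilbTensor U V') H)
    (Z := HilbTensor (HilbTensor U U') H →L[ℂ] HilbTensor (HilbTensor V V') H)
    (ContinuousLinearMap.compL ℂ _ _ _) ha.of_norm.hasSum hb.of_norm.hasSum ha hb
  refine HasSum.fiberwise_add (X := HilbTensor U U' →L[ℂ] HilbTensor V V')
    (Z := HilbTensor (HilbTensor U U') H →L[ℂ] HilbTensor (HilbTensor V V') H)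
    (Λ := fun r => ((mapHL (HilbTensor U U') (HilbTensor V V') H H).flip
      (opMonomial T r)).toLinearMap)
    (ψ := fun p => mapH (a p.1) (b p.2)) (hs.congr_fun fun p => ?_)
  rw [ContinuousLinearMap.compL_apply, ← mapH_comp, ← mapH_comp, ContinuousLinearMap.comp_id,
    ContinuousLinearMap.id_comp]
  exact congrArg (mapH _) (opMonomial_add hT _ _)

/-- The tensor product of two Schur–Agler functions is Schur–Agler. -/
theorem IsSchurAgler.tensor {f : (Fin d → ℂ) → (U →L[ℂ] V)} {g : (Fin d → ℂ) → (U' →L[ℂ] V')}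
    (hf : IsSchurAgler.{w} f) (hg : IsSchurAgler.{w} g) :
    IsSchurAgler.{w} fun z => mapH (f z) (g z) := by
  obtain ⟨hfan, a, ha, haT⟩ := isSchurAgler_iff.1 hf
  obtain ⟨hgan, b, hb, hbT⟩ := isSchurAgler_iff.1 hg
  have hasm := fun {t : ℝ} => summable_norm_coeff_mul (t := t) fun z hz => (ha z hz).summable
  have hbsm := fun {t : ℝ} => summable_norm_coeff_mul (t := t) fun z hz => (hb z hz).summable
  refine isSchurAgler_iff.2 ⟨((mapHL U V U' V').analyticOnNhd_bilinear Set.univ).comp₂ hfan hgan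
    fun _ _ => trivial, tensorCoeff a b, fun z hz => ?_, fun H _ _ _ T hT => ?_⟩
  · obtain ⟨t, h0, h1, ht⟩ := exists_bound_lt_one hz
    have hz' (r : Fin d → ℕ) : ‖∏ i, z i ^ r i‖ ≤ ∏ i, t ^ r i := by
      rw [norm_prod]
      refine Finset.prod_le_prod (fun i _ => norm_nonneg _) fun i _ => ?_
      rw [norm_pow]
      exact pow_le_pow_left₀ (norm_nonneg _) (ht i) _
    refine hasSum_tensorCoeff (ha z hz) (hb z hz)
      (.of_nonneg_of_le (fun _ => norm_nonneg _) (fun r => ?_) (hasm h0 h1))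
      (.of_nonneg_of_le (fun _ => norm_nonneg _) (fun r => ?_) (hbsm h0 h1)) <;>
    · rw [norm_smul, mul_comm]
      exact mul_le_mul_of_nonneg_left (hz' r) (norm_nonneg _)
  · obtain ⟨t, h0, h1, ht⟩ := exists_bound_lt_one hT.norm_lt_one
    obtain ⟨x, hx, hx1⟩ := haT H T hT
    obtain ⟨y, hy, hy1⟩ := hbT H T hT
    have hTn := norm_opMonomial_le h0 ht
    have hXs : Summable fun r => ‖mapH (mapH (a r) (.id ℂ V')) (opMonomial T r)‖ :=
      .of_nonneg_of_le (fun _ => norm_nonneg _) (fun r => (norm_mapH_le _ _).trans <|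
        mul_le_mul ((norm_mapH_le _ _).trans (mul_le_of_le_one_right (norm_nonneg _)
          ContinuousLinearMap.norm_id_le)) (hTn r) (norm_nonneg _) (norm_nonneg _)) (hasm h0 h1)
    have hYs : Summable fun r => ‖mapH (mapH (.id ℂ U) (b r)) (opMonomial T r)‖ :=
      .of_nonneg_of_le (fun _ => norm_nonneg _) (fun r => (norm_mapH_le _ _).trans <|
        mul_le_mul ((norm_mapH_le _ _).trans (mul_le_of_le_one_left (norm_nonneg _)
          ContinuousLinearMap.norm_id_le)) (hTn r) (norm_nonneg _) (norm_nonneg _)) (hbsm h0 h1)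
    -- The identity is attached to the coefficients, so the space `H` and the tuple `T` are those of
    -- the hypotheses.
    have hX1 := (norm_tsum_mapH_id_right_le (F := V') a (opMonomial T) hx.summable
      hXs.of_norm).trans (hx.tsum_eq.symm ▸ hx1)
    have hY1 := (norm_tsum_mapH_id_left_le (E := U) b (opMonomial T) hy.summable
      hYs.of_norm).trans (hy.tsum_eq.symm ▸ hy1)
    exact ⟨_, hasSum_mapH_tensorCoeff hT.commute hXs hYs,
      (ContinuousLinearMap.opNorm_comp_le _ _).trans (mul_le_one₀ hX1 (norm_nonneg _) hY1)⟩

end SchurAgler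

/-! ### Tensor powers and symmetric products. -/

section TensorPowers

variable {U : Type u} [NormedAddCommGroup U] [InnerProductSpace ℂ U]
  {V : Type v} [NormedAddCommGroup V] [InnerProductSpace ℂ V]

theorem inner_elemTensor {k : ℕ} (x y : Fin k → U) :
    inner ℂ (elemTensor k x) (elemTensor k y) = ∏ i, inner ℂ (x i) (y i) := by
  induction k with
  | zero =>
    change inner ℂ (EuclideanSpace.single PUnit.unit 1 : EuclideanSpace ℂ PUnit.{u + 1})
      (EuclideanSpace.single PUnit.unit 1) = _
    simp
  | succ k ih =>
    rw [Fin.prod_univ_succ]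
    refine (inner_htmul (x 0) (y 0) (elemTensor k (Fin.tail x))
      (elemTensor k (Fin.tail y))).trans ?_
    rw [ih]
    rfl

theorem tensorPowMap_elemTensor {k : ℕ} (A : Fin k → (U →L[ℂ] V)) (x : Fin k → U) :
    tensorPowMap k A (elemTensor k x) = elemTensor k fun i => A i (x i) := by
  induction k with
  | zero =>
    change LinearIsometryEquiv.piLpCongrLeft 2 ℂ ℂ Equiv.punitEquivPUnit.{u + 1, v + 1}
      (EuclideanSpace.single PUnit.unit 1 : EuclideanSpace ℂ PUnit.{u + 1}) =
      (EuclideanSpace.single PUnit.unit 1 : EuclideanSpace ℂ PUnit.{v + 1})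
    ext
    simp
  | succ k ih =>
    refine (hmap_htmul (A 0) (tensorPowMap k (Fin.tail A)) (x 0)
      (elemTensor k (Fin.tail x))).trans ?_
    rw [ih]
    rfl

/-- Tensor products of Schur–Agler functions are Schur–Agler. -/
theorem isSchurAgler_tensorPowMap {d k : ℕ} {S : Fin k → (Fin d → ℂ) → (U →L[ℂ] V)}
    (hS : ∀ j, IsSchurAgler.{w} (S j)) :
    IsSchurAgler.{w} fun z => tensorPowMap k fun j => S j z := by
  induction k with
  | zero =>
    refine isSchurAgler_const (U := EuclideanSpace ℂ PUnit.{u + 1})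
      (V := EuclideanSpace ℂ PUnit.{v + 1}) ?_
    exact (LinearIsometryEquiv.piLpCongrLeft 2 ℂ ℂ
      Equiv.punitEquivPUnit.{u + 1, v + 1}).toLinearIsometry.norm_toContinuousLinearMap_le
  | succ k ih => exact (hS 0).tensor (ih fun j => hS j.succ)

/-- Symmetric products of Schur–Agler functions are Schur–Agler. -/
theorem isSchurAgler_symProd {d k : ℕ} {S : Fin k → (Fin d → ℂ) → (U →L[ℂ] V)}
    (hS : ∀ j, IsSchurAgler.{w} (S j)) :
    IsSchurAgler.{w} fun z => symProd fun j => S j z :=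
  (isSchurAgler_tensorPowMap hS).comp_comp
    (SymPow V k).orthogonalProjectionOnto_norm_le (SymPow U k).norm_subtypeL_le

end TensorPowers

/-! ### Matrix and scalar compressions. -/

section Compression

variable {d : ℕ} {U : Type*} [NormedAddCommGroup U] [InnerProductSpace ℂ U]
  {f : (Fin d → ℂ) → (U →L[ℂ] U)}

/-- The matrix of a compression of a Schur–Agler function to the span of finitely many
orthonormal vectors is Schur–Agler. -/
theorem IsSchurAgler.isMatrixSchurAgler [CompleteSpace U] (hf : IsSchurAgler.{w} f)
    {ι : Type*} [Fintype ι] [DecidableEq ι] {e : ι → U} (he : Orthonormal ℂ e) :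
    IsMatrixSchurAgler.{w} fun z => Matrix.of fun i j => inner ℂ (e i) (f z (e j)) := by
  let b := EuclideanSpace.basisFun ι ℂ
  have hJe (i) : b.toBasis.constr ℂ e (b i) = e i := by
    rw [← b.coe_toBasis, Module.Basis.constr_basis]
  -- `J` sends the standard basis to `e`; the matrix in question represents `J* f J`.
  let J : EuclideanSpace ℂ ι →ₗᵢ[ℂ] U :=
    (b.toBasis.constr ℂ e).isometryOfOrthonormal (v := b.toBasis) (by simp)
      (by rw [b.coe_toBasis, show _ ∘ b = e from funext hJe]; exact he)
  have hJ (i) : J (b i) = e i := hJe i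
  have hn := J.norm_toContinuousLinearMap_le
  have hc := hf.comp_comp (A := J.toContinuousLinearMap.adjoint) (B := J.toContinuousLinearMap)
    (by rwa [LinearIsometryEquiv.norm_map]) hn
  unfold IsMatrixSchurAgler
  convert hc using 2 with z
  apply ContinuousLinearMap.coe_injective
  refine b.toBasis.ext fun j => ?_
  ext i
  rw [b.coe_toBasis, ← EuclideanSpace.basisFun_inner, ← EuclideanSpace.basisFun_inner]
  change _ = inner ℂ (b i) (J.toContinuousLinearMap.adjoint (f z (J (b j))))
  rw [ContinuousLinearMap.adjoint_inner_right]
  change _ = inner ℂ (J (b i)) (f z (J (b j)))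
  rw [hJ, hJ, EuclideanSpace.basisFun_apply, EuclideanSpace.basisFun_apply]
  simp [EuclideanSpace.inner_single_left]

theorem IsSchurAgler.isScalarSchurAgler (hf : IsSchurAgler.{w} f) {e : U} (he : ‖e‖ = 1) :
    IsScalarSchurAgler.{w} fun z => inner ℂ e (f z e) := by
  have hc := hf.comp_comp (A := innerSL ℂ e) (B := ContinuousLinearMap.toSpanSingleton ℂ e)
    (by rw [innerSL_apply_norm, he]) (by rw [ContinuousLinearMap.norm_toSpanSingleton, he])
  unfold IsScalarSchurAgler
  convert hc using 2 with z
  ext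
  simp

end Compression

/-! ### Permanents as matrix entries between symmetric tensors. -/

section Permanents

variable {n k : ℕ}

theorem permanent_submatrix_comp_perm {M : Matrix (Fin n) (Fin n) ℂ} (α β : Fin k → Fin n)
    (τ : Equiv.Perm (Fin k)) :
    (M.submatrix α (β ∘ τ)).permanent = (M.submatrix α β).permanent :=
  Matrix.permanent_permute_rows τ (M.submatrix α β)

/-- The symmetric tensor `e_{α₁} ∨ ⋯ ∨ e_{α_k}` of standard basis vectors. -/
def basisSymTensor (α : Fin k → Fin n) : HTensorPow (EuclideanSpace ℂ (Fin n)) k :=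
  symTensor fun i => EuclideanSpace.single (α i) 1

/-- Expanding both tensors gives a double sum over `σ` and `τ`. For fixed `τ` the sum over `σ` is
the permanent with columns permuted by `τ`, which does not depend on `τ`; there are `k!` choices of
`τ`. -/
theorem inner_basisSymTensor_map (M : Matrix (Fin n) (Fin n) ℂ) (α β : Fin k → Fin n) :
    inner ℂ (basisSymTensor α) (tensorPowMap k (fun _ => Matrix.toEuclideanCLM (𝕜 := ℂ) M)
      (basisSymTensor β)) = k.factorial * (M.submatrix α β).permanent := by
  have h (σ τ : Equiv.Perm (Fin k)) :
      inner ℂ (elemTensor k ((fun i => EuclideanSpace.single (α i) (1 : ℂ)) ∘ σ))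
        (tensorPowMap k (fun _ => Matrix.toEuclideanCLM (𝕜 := ℂ) M)
          (elemTensor k ((fun i => EuclideanSpace.single (β i) (1 : ℂ)) ∘ τ))) =
      ∏ i, M (α (σ i)) (β (τ i)) := by
    rw [tensorPowMap_elemTensor, inner_elemTensor]
    refine Finset.prod_congr rfl fun i _ => ?_
    simp [EuclideanSpace.inner_single_left]
  rw [basisSymTensor, basisSymTensor, symTensor, symTensor, map_sum, inner_sum]
  simp_rw [sum_inner, h]
  have h2 (τ : Equiv.Perm (Fin k)) : ∑ σ : Equiv.Perm (Fin k), ∏ i, M (α (σ i)) (β (τ i)) =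
      (M.submatrix α β).permanent := by
    rw [← permanent_submatrix_comp_perm α β τ]
    rfl
  simp [h2, Fintype.card_perm]

theorem permanent_submatrix_one (α β : Fin k → Fin n) :
    ((1 : Matrix (Fin n) (Fin n) ℂ).submatrix α β).permanent =
      Fintype.card {σ : Equiv.Perm (Fin k) // α ∘ σ = β} := by
  rw [Matrix.permanent, Fintype.card_subtype, Finset.natCast_card_filter]
  refine Finset.sum_congr rfl fun σ _ => ?_
  simp only [Matrix.submatrix_apply, Matrix.one_apply, funext_iff, Function.comp_apply]
  rw [Finset.prod_ite_zero]
  simp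

/-- The permanent counts the permutations of positions that fix `α`; these permute each level set
separately. -/
theorem permanent_submatrix_one_self (α : Fin k → Fin n) :
    ((1 : Matrix (Fin n) (Fin n) ℂ).submatrix α α).permanent = multFactorial α := by
  rw [permanent_submatrix_one, DomMulAct.stabilizer_card, multFactorial]
  simp [Fintype.card_subtype]

/-- A nonzero count would make `β` a rearrangement of `α`, and a sequence has only one monotone
rearrangement. -/
theorem permanent_submatrix_one_of_ne {α β : Fin k → Fin n} (hα : Monotone α) (hβ : Monotone β)
    (h : α ≠ β) : ((1 : Matrix (Fin n) (Fin n) ℂ).submatrix α β).permanent = 0 := by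
  rw [permanent_submatrix_one, Nat.cast_eq_zero, Fintype.card_eq_zero_iff]
  refine ⟨fun ⟨σ, hσ⟩ => h ?_⟩
  rw [← hσ]
  exact Tuple.unique_monotone (f := α) (σ := 1) (τ := σ) (by simpa using hα) (hσ ▸ hβ)

theorem multFactorial_pos (α : Fin k → Fin n) : 0 < multFactorial α :=
  Finset.prod_pos fun _ _ => Nat.factorial_pos _

theorem multFactorial_of_injective {α : Fin k → Fin n} (hα : Function.Injective α) :
    multFactorial α = 1 := by
  refine Finset.prod_eq_one fun i _ => Nat.factorial_eq_one.2 ?_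
  refine Finset.card_le_one.2 fun a ha b hb => hα ?_
  simp only [Finset.mem_filter] at ha hb
  rw [ha.2, hb.2]

/-- The normalized symmetric tensor of standard basis vectors. -/
def basisSymTensorNormalized (α : Fin k → Fin n) : HTensorPow (EuclideanSpace ℂ (Fin n)) k :=
  ((Real.sqrt (k.factorial * multFactorial α) : ℂ)⁻¹) • basisSymTensor α

/-- The squared norm of `basisSymTensor α` is `k! μ(α)`, so normalizing cancels the factor `k!` and
leaves `√(μ(α) μ(β))`. -/
theorem inner_basisSymTensorNormalized_map (M : Matrix (Fin n) (Fin n) ℂ) (α β : Fin k → Fin n) :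
    inner ℂ (basisSymTensorNormalized α)
      (tensorPowMap k (fun _ => Matrix.toEuclideanCLM (𝕜 := ℂ) M) (basisSymTensorNormalized β)) =
      (M.submatrix α β).permanent / (Real.sqrt (multFactorial α * multFactorial β) : ℂ) := by
  have hα : (0 : ℝ) < multFactorial α := by exact_mod_cast multFactorial_pos α
  have hβ : (0 : ℝ) < multFactorial β := by exact_mod_cast multFactorial_pos β
  have hk : (0 : ℝ) < k.factorial := by exact_mod_cast k.factorial_pos
  rw [basisSymTensorNormalized, basisSymTensorNormalized, map_smul, inner_smul_left,
    inner_smul_right, inner_basisSymTensor_map, map_inv₀, Complex.conj_ofReal,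
    Real.sqrt_mul hk.le, Real.sqrt_mul hk.le, Real.sqrt_mul hα.le]
  have hsk : (Real.sqrt k.factorial : ℂ) * Real.sqrt k.factorial = k.factorial := by
    exact_mod_cast Real.mul_self_sqrt hk.le
  have h1 : (Real.sqrt k.factorial : ℂ) ≠ 0 := by exact_mod_cast (Real.sqrt_pos.2 hk).ne'
  have h2 : (Real.sqrt (multFactorial α) : ℂ) ≠ 0 := by exact_mod_cast (Real.sqrt_pos.2 hα).ne'
  have h3 : (Real.sqrt (multFactorial β) : ℂ) ≠ 0 := by exact_mod_cast (Real.sqrt_pos.2 hβ).ne'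
  push_cast
  rw [← hsk]
  field_simp

theorem inner_basisSymTensorNormalized (α β : Fin k → Fin n) :
    inner ℂ (basisSymTensorNormalized α) (basisSymTensorNormalized β) =
      ((1 : Matrix (Fin n) (Fin n) ℂ).submatrix α β).permanent /
        (Real.sqrt (multFactorial α * multFactorial β) : ℂ) := by
  -- The Gram matrix is the case `M = 1`, as the tensor power of the identity fixes symmetric
  -- tensors.
  rw [← inner_basisSymTensorNormalized_map]
  congr 1
  simp only [basisSymTensorNormalized, map_smul, basisSymTensor, symTensor, map_sum,
    tensorPowMap_elemTensor, map_one]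
  rfl

theorem orthonormal_basisSymTensorNormalized :
    Orthonormal ℂ fun α : {α : Fin k → Fin n // Monotone α} =>
      basisSymTensorNormalized α.1 := by
  rw [orthonormal_iff_ite]
  rintro ⟨α, hα⟩ ⟨β, hβ⟩
  rw [inner_basisSymTensorNormalized]
  split_ifs with h
  · obtain rfl : α = β := congrArg Subtype.val h
    rw [permanent_submatrix_one_self, Real.sqrt_mul_self (Nat.cast_nonneg _)]
    exact div_self (by exact_mod_cast (multFactorial_pos α).ne')
  · rw [permanent_submatrix_one_of_ne hα hβ fun h' => h (Subtype.ext h'), zero_div]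

end Permanents

end

theorem mainTheorem11 (d : ℕ) :
    (∀ (U : Type u) [NormedAddCommGroup U] [InnerProductSpace ℂ U] [CompleteSpace U]
        (V : Type v) [NormedAddCommGroup V] [InnerProductSpace ℂ V] [CompleteSpace V]
        (k : ℕ) (S : Fin k → (Fin d → ℂ) → (U →L[ℂ] V)),
        (∀ j, IsSchurAgler.{w} (S j)) →
          IsSchurAgler.{w} fun z => symProd fun j => S j z) ∧
    (∀ (n : ℕ) (S : (Fin d → ℂ) → Matrix (Fin n) (Fin n) ℂ), IsMatrixSchurAgler.{w} S →
        (∀ k : ℕ, IsMatrixSchurAgler.{w} fun z => permCompound k (S z)) ∧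
        (∀ k : ℕ, IsMatrixSchurAgler.{w} fun z => permInduced k (S z)) ∧
        IsScalarSchurAgler.{w} fun z => (S z).permanent) := by
  refine ⟨fun U _ _ _ V _ _ _ k S hS => isSchurAgler_symProd hS, fun n S hS => ?_⟩
  -- The normalized symmetric tensors already lie in the full tensor power, so `S^{⊗k}` can be
  -- compressed directly, without passing through `symProd`.
  have hT (k : ℕ) := isSchurAgler_tensorPowMap (k := k) fun _ => hS
  refine ⟨fun k => ?_, fun k => ?_, ?_⟩
  -- Strictly increasing sequences pick out a subfamily of the orthonormal one, with `μ = 1`.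
  · convert (hT k).isMatrixSchurAgler (orthonormal_basisSymTensorNormalized.comp
      (fun α : Fin k ↪o Fin n => (⟨α, α.monotone⟩ : {α : Fin k → Fin n // Monotone α}))
      fun α β h => DFunLike.coe_injective (congrArg Subtype.val h)) using 2 with z
    ext α β
    simp [inner_basisSymTensorNormalized_map, permCompound,
      multFactorial_of_injective α.injective, multFactorial_of_injective β.injective]
  · convert (hT k).isMatrixSchurAgler orthonormal_basisSymTensorNormalized using 2 with z
    ext α β
    simp [inner_basisSymTensorNormalized_map, permInduced]
  -- The permanent is the diagonal entry for `k = n` at the sequence `1, …, n`.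
  · convert (hT n).isScalarSchurAgler
      (orthonormal_basisSymTensorNormalized.norm_eq_one ⟨id, monotone_id⟩) using 2 with z
    simp [inner_basisSymTensorNormalized_map, multFactorial_of_injective Function.injective_id]
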